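/- **Setting.** Consider a tabular episodic Markov decision process with finite state space $\mathcal S$ of size $S$, finite action space $\mathcal A$ of size $A\ge 1$, horizon $H$, transition probabilities $P_h(\cdot\mid s,a)$ for $h\in[H]$, and a fixed starting state $s_1$. A policy $\pi$ is a family of maps $\pi_h:\mathcal S\to\Delta_{\mathcal A}$, $h\in[H]$, and the reachability of $s$ at step $h$ is $\delta_h(s)=\max_\pi P^\pi(s_h=s)$, for trajectories started at $s_1$ at step $1$. **Algorithm.** The exploration phase of UCBZero with parameters $c>0$, number of tasks $N\ge 1$, number of episodes $K$ and $p\in(0,1)$ is the following. Put $\iota=\log(SAHK/p)$, $b_t=c\sqrt{H^3(\log N+\iota)/t}$ and $\alpha_t=\frac{H+1}{H+t}$. Initialize $\bar Q_h(s,a)=H$ and $N_h(s,a)=0$ for all $(s,a,h)$. In each episode $k=1,\dots,K$, start at $s_1^k=s_1$, and for $h=1,\dots,H$: take an action $a_h^k\in\arg\max_a\bar Q_h(s_h^k,a)$ (ties are broken arbitrarily), observe $s_{h+1}^k\sim P_h(\cdot\mid s_h^k,a_h^k)$, increase $N_h(s_h^k,a_h^k)$ by one, let $t$ be its new value, and set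 $$\bar Q_h(s_h^k,a_h^k)\leftarrow(1-\alpha_t)\,\bar Q_h(s_h^k,a_h^k)+\alpha_t\bigl[\bar V_{h+1}(s_{h+1}^k)+2b_t\bigr],$$ where $\bar V_{h}(s)=\min\bigl(H,\max_a\bar Q_{h}(s,a)\bigr)$ for $h\le H$ and $\bar V_{H+1}=0$. **Theorem.** There are absolute constants $c,C_1,C_2>0$ such that for every such Markov decision process, all $N\ge1$ and $K$, every $p\in(0,1)$ and every way of breaking ties, the following holds for UCBZero run with bonus constant $c$: with probability at least $1-p$, after $K$ episodes the visit counts satisfy, simultaneously for all $(s,a,h)\in\mathcal S\times\mathcal A\times[H]$ with $K\,\delta_h(s)^2\ge C_1H^3SA(\log N+\iota)$, $$N_h^K(s,a)\;\ge\; C_2\,\frac{K\,\delta_h(s)^2}{H^2SA}.$$ -/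

import Mathlib

noncomputable section

namespace UCBZero

/-- A tabular episodic MDP without rewards, with horizon `H` and fixed starting state `s₁`.
Steps are numbered `1, …, H`, and `P h s a` is the law of the next state when action `a` is taken
in state `s` at step `h`; the values of `P` at other indices `h` are never used. -/
structure EpisodicMDP (S A : Type*) where
  H : ℕ
  P : ℕ → S → A → PMF S
  s₁ : S

/-- A (stochastic, step-dependent) policy: `π h s` is the law of the action at step `h`. -/
abbrev Policy (S A : Type*) := ℕ → S → PMF A

variable {S A : Type*}

/-- The law of the state `n` steps later, for the policy `π` started in state `s` at step `h`. -/
def stateLaw (M : EpisodicMDP S A) (π : Policy S A) : ℕ → ℕ → S → PMF S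
  | 0, _, s => PMF.pure s
  | n + 1, h, s => (π h s).bind fun a => (M.P h s a).bind fun s' => stateLaw M π n (h + 1) s'

/-- Relative reachability `δ_{h',h}(s',s)` (for `h' ≤ h`): the maximal probability, over policies,
of being in `s` at step `h` given state `s'` at step `h'`. -/
def relReach (M : EpisodicMDP S A) (h' h : ℕ) (s' s : S) : ℝ :=
  (⨆ π : Policy S A, stateLaw M π (h - h') h' s' s).toReal

/-- Reachability `δ_h(s)` of state `s` at step `h`, from the starting state. -/
def reach (M : EpisodicMDP S A) (h : ℕ) (s : S) : ℝ :=
  relReach M 1 h M.s₁ s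

/-- The content of the learner's memory: the pseudo-`Q` table, the visit counts `N_h(s,a)`, and
the transitions `(h, s, a, s')` observed so far, the most recent one first. -/
structure Memory (S A : Type*) where
  Q : ℕ → S → A → ℝ
  count : ℕ → S → A → ℕ
  data : List (ℕ × S × A × S)

/-- Initialization: `Q_h(s,a) = H` and `N_h(s,a) = 0`. -/
def initMemory (S A : Type*) (H : ℕ) : Memory S A where
  Q := fun _ _ _ => H
  count := fun _ _ _ => 0
  data := []

/-- `V_h(s) = min (H, max_a Q_h(s,a))` for `h ≤ H`, and `V_{H+1} = 0`. -/
def vbar [Fintype A] [Nonempty A] (H : ℕ) (m : Memory S A) (h : ℕ) (s : S) : ℝ :=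
  if h ≤ H then min (H : ℝ) (Finset.univ.sup' Finset.univ_nonempty (m.Q h s)) else 0

/-- The logarithmic factor `log N + ι`, where `ι = log (S A H K / p)`. -/
def logFactor (S A : Type*) [Fintype S] [Fintype A] (H N K : ℕ) (p : ℝ) : ℝ :=
  Real.log N + Real.log (Fintype.card S * Fintype.card A * H * K / p)

/-- The bonus `b_t = c √(H³ L / t)`; `L` will be `logFactor`. -/
def bonus (c L : ℝ) (H t : ℕ) : ℝ :=
  c * √((H : ℝ) ^ 3 * L / t)

/-- The learning rate `α_t = (H + 1) / (H + t)`. -/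
def rate (H t : ℕ) : ℝ :=
  ((H : ℝ) + 1) / ((H : ℝ) + t)

/-- The update after observing the transition from `s` to `s'` under action `a` at step `h`. -/
def Memory.update [DecidableEq S] [DecidableEq A] [Fintype A] [Nonempty A] (m : Memory S A)
    (H : ℕ) (c L : ℝ) (h : ℕ) (s : S) (a : A) (s' : S) : Memory S A :=
  let t := m.count h s a + 1
  { count := fun i x b => if i = h ∧ x = s ∧ b = a then t else m.count i x b
    Q := fun i x b => if i = h ∧ x = s ∧ b = a then
        (1 - rate H t) * m.Q h s a + rate H t * (vbar H m (h + 1) s' + 2 * bonus c L H t)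
      else m.Q i x b
    data := (h, s, a, s') :: m.data }

/-- A rule for picking an action from the memory, the step and the current state. -/
abbrev ActionRule (S A : Type*) := Memory S A → ℕ → S → PMF A

/-- The rule only picks actions in `argmax_a Q_h(s,a)`; ties may be broken in any way, also
at random or depending on the past. -/
def IsGreedy (g : ActionRule S A) : Prop :=
  ∀ m h s, ∀ a ∈ (g m h s).support, ∀ b, m.Q h s b ≤ m.Q h s a

section Run

variable [DecidableEq S] [DecidableEq A] [Fintype A] [Nonempty A]

/-- The law of the memory after the `n` steps `h, …, h + n - 1`, when the state at step `h`
is `s` and the memory before step `h` is `m`. -/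
def runSteps (M : EpisodicMDP S A) (c L : ℝ) (g : ActionRule S A) :
    ℕ → ℕ → S → Memory S A → PMF (Memory S A)
  | 0, _, _, m => PMF.pure m
  | n + 1, h, s, m =>
    (g m h s).bind fun a => (M.P h s a).bind fun s' =>
      runSteps M c L g n (h + 1) s' (m.update M.H c L h s a s')

/-- The law of the memory after `k` episodes, each of which consists of the steps `1, …, H`
and starts in `s₁`. -/
def runEpisodes (M : EpisodicMDP S A) (c L : ℝ) (g : ActionRule S A) : ℕ → PMF (Memory S A)
  | 0 => PMF.pure (initMemory S A M.H)
  | k + 1 => (runEpisodes M c L g k).bind fun m => runSteps M c L g M.H 1 M.s₁ m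

/-- The law of the memory after the exploration phase of UCBZero with `K` episodes, `N` tasks,
failure probability `p`, bonus constant `c`, and action rule `g`. -/
def ucbZero [Fintype S] (M : EpisodicMDP S A) (c : ℝ) (N K : ℕ) (p : ℝ) (g : ActionRule S A) :
    PMF (Memory S A) :=
  runEpisodes M c (logFactor S A M.H N K p) g K

end Run

end UCBZero

end

/-! Write L = log N + ι. Fix a target (s,a,h) with final count n, and let B = min(H, 2 b_n), or B =
H if n = 0. Each update of Q_h(s,a) averages in at least 2 b_t, and b_t decreases in t, so Q_h(s,a)
≥ B throughout the run (`level_le_replay_Q`). Thus B acts as a reward at s in step h, and optimism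
carries it back to the start: V_1(s_1) ≥ B δ_h(s) at every stage (`level_mul_reach_le_vbar`). Chance
enters only here: the updates average δ_{h'+1,h}(·,s) over sampled next states, and the bonus must
absorb the lower deviations of these averages. Exponential supermartingales and a union bound
control them all (`toOuterMeasure_not_concentratedData_le`). B depends on the run, but it only
multiplies deviations of reachabilities, so the good event need not mention it.

Conversely, there are no rewards, so large values can only stem from the initialization and the
bonuses. A potential argument (`sumValue_add_sum_le`) bounds the summed values at a step by 1 + 1/H
times the summed next values and bonuses, up to the initial cost. Iterating over the steps
(`EpisodeData.sumValue_one_le`) bounds the sum of V_1(s_1) by O(H² SA + √(H⁵ SA K L)). This half is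
deterministic.

Together, K B δ ≤ 51 √(H⁵ SA K L). The threshold on K δ² excludes B = H, and B = 2 b_n = 4 √(H³ L /
n) then gives the lower bound on n. -/

noncomputable section

namespace UCBZero

open scoped ENNReal

/-! ### Expectations of nonnegative functions under a probability mass function -/

section Expect

variable {α β : Type*}

/-- The expectation of a nonnegative function under a probability mass function. -/
def expect (p : PMF α) (f : α → ℝ≥0∞) : ℝ≥0∞ := ∑' a, p a * f a

theorem expect_pure (a : α) (f : α → ℝ≥0∞) : expect (PMF.pure a) f = f a := by
  classical
  unfold expect
  rw [tsum_eq_single a]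
  · simp
  · intro b hb
    simp [PMF.pure_apply, hb]

theorem expect_bind (p : PMF α) (q : α → PMF β) (f : β → ℝ≥0∞) :
    expect (p.bind q) f = expect p fun a => expect (q a) f := by
  unfold expect
  simp_rw [PMF.bind_apply, ← ENNReal.tsum_mul_right, ← ENNReal.tsum_mul_left]
  rw [ENNReal.tsum_comm]
  simp_rw [mul_assoc]

theorem expect_const (p : PMF α) (c : ℝ≥0∞) : expect p (fun _ => c) = c := by
  unfold expect
  rw [ENNReal.tsum_mul_right, p.tsum_coe, one_mul]

theorem expect_mono (p : PMF α) {f g : α → ℝ≥0∞} (h : ∀ a, f a ≤ g a) :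
    expect p f ≤ expect p g :=
  ENNReal.tsum_le_tsum fun a => by gcongr; exact h a

theorem expect_le_of_forall_le (p : PMF α) {f : α → ℝ≥0∞} {c : ℝ≥0∞} (h : ∀ a, f a ≤ c) :
    expect p f ≤ c :=
  (expect_mono p h).trans_eq (expect_const p c)

theorem expect_ofReal [Fintype α] (p : PMF α) {f : α → ℝ} (hf : ∀ a, 0 ≤ f a) :
    expect p (fun a => ENNReal.ofReal (f a)) = ENNReal.ofReal (∑ a, (p a).toReal * f a) := by
  unfold expect
  rw [tsum_fintype, ENNReal.ofReal_sum_of_nonneg fun a _ =>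
    mul_nonneg ENNReal.toReal_nonneg (hf a)]
  refine Finset.sum_congr rfl fun a _ => ?_
  rw [ENNReal.ofReal_mul ENNReal.toReal_nonneg, ENNReal.ofReal_toReal (p.apply_ne_top a)]

theorem sum_toReal_eq_one [Fintype α] (p : PMF α) : ∑ a, (p a).toReal = 1 := by
  rw [← ENNReal.toReal_sum fun a _ => p.apply_ne_top a,
    ← tsum_fintype (L := .unconditional _), p.tsum_coe]
  simp

/-- Markov's inequality. -/
theorem toOuterMeasure_le_of_expect_le_one (p : PMF α) (f : α → ℝ≥0∞) {q : ℝ≥0∞}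
    (hf : expect p f ≤ 1) {s : Set α} (hs : ∀ a ∈ s, 1 ≤ q * f a) :
    p.toOuterMeasure s ≤ q := by
  rw [PMF.toOuterMeasure_apply]
  calc ∑' a, s.indicator p a ≤ ∑' a, q * (p a * f a) := by
        refine ENNReal.tsum_le_tsum fun a => ?_
        by_cases ha : a ∈ s
        · rw [Set.indicator_of_mem ha]
          calc p a = p a * 1 := (mul_one _).symm
            _ ≤ p a * (q * f a) := by gcongr; exact hs a ha
            _ = q * (p a * f a) := by ring
        · simp [Set.indicator_of_notMem ha]
    _ = q * expect p f := by rw [ENNReal.tsum_mul_left, expect]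
    _ ≤ q * 1 := by gcongr
    _ = q := mul_one q

theorem ofReal_one_sub_le_toOuterMeasure (p : PMF α) {s t : Set α} {q : ℝ} (hq : 0 ≤ q)
    (ht : p.toOuterMeasure t ≤ ENNReal.ofReal q) (hst : ∀ a ∈ p.support, a ∉ t → a ∈ s) :
    ENNReal.ofReal (1 - q) ≤ p.toOuterMeasure s := by
  have h1 : (1 : ℝ≥0∞) ≤ p.toOuterMeasure s + p.toOuterMeasure t := by
    calc (1 : ℝ≥0∞) = p.toOuterMeasure Set.univ := by
          rw [PMF.toOuterMeasure_apply]; simp [p.tsum_coe]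
      _ ≤ p.toOuterMeasure (s ∪ t) := by
          refine PMF.toOuterMeasure_mono p fun a ha => ?_
          by_cases h : a ∈ t
          · exact Or.inr h
          · exact Or.inl (hst a ha.2 h)
      _ ≤ _ := MeasureTheory.measure_union_le s t
  rw [ENNReal.ofReal_sub _ hq, ENNReal.ofReal_one]
  exact tsub_le_iff_right.2 (h1.trans (by gcongr))

/-- Hoeffding's lemma for the mean-zero variable `f - μ` with values in `[-1, 1]`. -/
theorem sum_mul_exp_le [Fintype α] (p : PMF α) (f : α → ℝ) (h0 : ∀ a, 0 ≤ f a)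
    (h1 : ∀ a, f a ≤ 1) (θ : ℝ) :
    ∑ a, (p a).toReal * Real.exp (-(θ * (f a - ∑ b, (p b).toReal * f b)) - θ ^ 2 / 2) ≤ 1 := by
  set μ := ∑ b, (p b).toReal * f b with hμ
  have hsum := sum_toReal_eq_one p
  have hμ0 : 0 ≤ μ := Finset.sum_nonneg fun a _ => mul_nonneg ENNReal.toReal_nonneg (h0 a)
  have hμ1 : μ ≤ 1 := by
    rw [hμ, ← hsum]
    exact Finset.sum_le_sum fun a _ => mul_le_of_le_one_right ENNReal.toReal_nonneg (h1 a)
  -- On [-1, 1] the convex function exp(-θx) lies below its chord, which is cosh θ - x sinh θ; the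
  -- linear term has mean zero.
  have key : ∀ a, Real.exp (-(θ * (f a - μ))) ≤ Real.cosh θ - (f a - μ) * Real.sinh θ := by
    intro a
    set x := f a - μ with hx
    have hx1 : x ≤ 1 := by linarith [h1 a]
    have hx0 : -1 ≤ x := by linarith [h0 a]
    have := convexOn_exp.2 (Set.mem_univ (-θ)) (Set.mem_univ θ)
      (show 0 ≤ (1 + x) / 2 by linarith) (show 0 ≤ (1 - x) / 2 by linarith) (by ring)
    simp only [smul_eq_mul] at this
    rw [Real.cosh_eq, Real.sinh_eq]
    calc Real.exp (-(θ * x)) = Real.exp ((1 + x) / 2 * -θ + (1 - x) / 2 * θ) := by ring_nf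
      _ ≤ _ := this
      _ = _ := by ring
  calc ∑ a, (p a).toReal * Real.exp (-(θ * (f a - μ)) - θ ^ 2 / 2)
      ≤ ∑ a, (p a).toReal * ((Real.cosh θ - (f a - μ) * Real.sinh θ)
          * Real.exp (-(θ ^ 2 / 2))) := by
        refine Finset.sum_le_sum fun a _ => ?_
        refine mul_le_mul_of_nonneg_left ?_ ENNReal.toReal_nonneg
        rw [sub_eq_add_neg, Real.exp_add]
        exact mul_le_mul_of_nonneg_right (key a) (Real.exp_pos _).le
    _ = (Real.cosh θ * ∑ a, (p a).toReal
          - (∑ a, (p a).toReal * f a - μ * ∑ a, (p a).toReal) * Real.sinh θ)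
          * Real.exp (-(θ ^ 2 / 2)) := by
        simp only [Finset.mul_sum, Finset.sum_mul, ← Finset.sum_sub_distrib]
        refine Finset.sum_congr rfl fun a _ => ?_
        ring
    _ = Real.cosh θ * Real.exp (-(θ ^ 2 / 2)) := by rw [hsum, ← hμ]; ring
    _ ≤ Real.exp (θ ^ 2 / 2) * Real.exp (-(θ ^ 2 / 2)) := by
        gcongr; exact Real.cosh_le_exp_half_sq θ
    _ = 1 := by rw [← Real.exp_add]; simp

end Expect

/-! ### Reachability -/

section Reach

variable {S A : Type*} (M : EpisodicMDP S A)

theorem relReach_nonneg (h' h : ℕ) (s' s : S) : 0 ≤ relReach M h' h s' s :=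
  ENNReal.toReal_nonneg

theorem iSup_stateLaw_le_one (n h : ℕ) (s' s : S) :
    ⨆ π : Policy S A, stateLaw M π n h s' s ≤ 1 :=
  iSup_le fun _ => PMF.coe_le_one _ _

theorem relReach_le_one (h' h : ℕ) (s' s : S) : relReach M h' h s' s ≤ 1 :=
  ENNReal.toReal_le_of_le_ofReal zero_le_one (by simpa using iSup_stateLaw_le_one M _ _ s' s)

theorem stateLaw_le_ofReal_relReach (π : Policy S A) (h' h : ℕ) (s' s : S) :
    stateLaw M π (h - h') h' s' s ≤ ENNReal.ofReal (relReach M h' h s' s) := by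
  rw [relReach, ENNReal.ofReal_toReal
    ((iSup_stateLaw_le_one M _ _ s' s).trans_lt ENNReal.one_lt_top).ne]
  exact le_iSup (fun π : Policy S A => stateLaw M π (h - h') h' s' s) π

theorem relReach_self_le [DecidableEq S] (h : ℕ) (s' s : S) :
    relReach M h h s' s ≤ if s' = s then 1 else 0 := by
  split_ifs with hs
  · exact relReach_le_one M h h s' s
  · refine ENNReal.toReal_le_of_le_ofReal le_rfl (iSup_le fun π => ?_)
    simp [stateLaw, PMF.pure_apply, Ne.symm hs]

/-- The mean of `δ_{h'+1,h}(·, s)` after taking action `a` in state `s'` at step `h'`. -/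
def meanReach [Fintype S] (h' : ℕ) (s' : S) (a : A) (h : ℕ) (s : S) : ℝ :=
  ∑ x, (M.P h' s' a x).toReal * relReach M (h' + 1) h x s

theorem meanReach_le_one [Fintype S] (h' : ℕ) (s' : S) (a : A) (h : ℕ) (s : S) :
    meanReach M h' s' a h s ≤ 1 := by
  rw [← sum_toReal_eq_one (M.P h' s' a)]
  exact Finset.sum_le_sum fun x _ =>
    mul_le_of_le_one_right ENNReal.toReal_nonneg (relReach_le_one M _ _ _ _)

/-- The Bellman inequality for reachability. -/
theorem relReach_le_of_meanReach_le [Fintype S] {h' h : ℕ} (hh : h' < h) {s' s : S} {v : ℝ}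
    (hv : 0 ≤ v) (h1 : ∀ a, meanReach M h' s' a h s ≤ v) : relReach M h' h s' s ≤ v := by
  refine ENNReal.toReal_le_of_le_ofReal hv (iSup_le fun π => ?_)
  obtain ⟨n, hn⟩ : ∃ n, h - h' = n + 1 := ⟨h - h' - 1, by omega⟩
  have hn' : n = h - (h' + 1) := by omega
  rw [hn, stateLaw, PMF.bind_apply]
  refine expect_le_of_forall_le (π h' s') fun a => ?_
  rw [PMF.bind_apply, hn']
  refine (expect_mono (M.P h' s' a) fun x =>
    stateLaw_le_ofReal_relReach M π (h' + 1) h x s).trans ?_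
  rw [expect_ofReal _ fun x => relReach_nonneg M _ _ x s]
  exact ENNReal.ofReal_le_ofReal (h1 a)

end Reach

/-! ### Learning rates -/

section Rates

/-- The first sample therefore erases the initial value H, which is why unvisited pairs are treated
separately below. -/
theorem rate_one (H : ℕ) : rate H 1 = 1 := by
  unfold rate
  push_cast
  exact div_self (by positivity)

theorem one_sub_rate_succ (H n : ℕ) : 1 - rate H (n + 1) = n / ((H : ℝ) + n + 1) := by
  unfold rate
  push_cast
  field_simp
  ring

theorem one_sub_rate_succ_nonneg (H n : ℕ) : 0 ≤ 1 - rate H (n + 1) := by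
  rw [one_sub_rate_succ]; positivity

theorem rate_nonneg (H t : ℕ) : 0 ≤ rate H t := by
  unfold rate; positivity

/-- The sum of the squared weights that the first `n` samples have in the running average with
learning rates `rate H`. -/
def rateVar (H : ℕ) : ℕ → ℝ
  | 0 => 0
  | n + 1 => (1 - rate H (n + 1)) ^ 2 * rateVar H n + rate H (n + 1) ^ 2

/-- The variance proxy of the running average after n samples is at most 2H/n; with values of size H
this accounts for the H³/t in the bonus. -/
theorem rateVar_le {H : ℕ} (hH : 1 ≤ H) (n : ℕ) : n * rateVar H n ≤ 2 * H := by
  have hH' : (1 : ℝ) ≤ H := by exact_mod_cast hH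
  induction n with
  | zero => simp [rateVar]
  | succ n ih =>
    have hn : (0 : ℝ) ≤ n := n.cast_nonneg
    rw [rateVar, one_sub_rate_succ, rate]
    push_cast
    have hpos : 0 < ((H : ℝ) + n + 1) ^ 2 := by positivity
    have h1 : (n / ((H : ℝ) + n + 1)) ^ 2 * rateVar H n + ((H + 1) / (H + (n + 1))) ^ 2
        = (n * (n * rateVar H n) + (H + 1) ^ 2) / ((H : ℝ) + n + 1) ^ 2 := by
      field_simp
      ring
    rw [h1, mul_div_assoc', div_le_iff₀ hpos]
    have h2 : n * (n * rateVar H n) ≤ n * (2 * (H : ℝ)) := mul_le_mul_of_nonneg_left ih hn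
    have h3 : ((n : ℝ) + 1) * (n * (n * rateVar H n) + (H + 1) ^ 2)
        ≤ (n + 1) * (n * (2 * (H : ℝ)) + (H + 1) ^ 2) := by gcongr
    refine h3.trans ?_
    have h4 : 0 ≤ ((n : ℝ) + 1) * (H ^ 2 - 1) := mul_nonneg (by positivity) (by nlinarith)
    have h5 : 0 ≤ ((n : ℝ) + 1) * H ^ 2 := by positivity
    have h6 : (0 : ℝ) ≤ H ^ 3 := by positivity
    nlinarith

/-- The factor by which a running average loses weight between samples `n` and `t`. -/
def decay (H t n : ℕ) : ℝ := ∏ j ∈ Finset.Ico n t, (1 - rate H (j + 1))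

theorem decay_self (H t : ℕ) : decay H t t = 1 := by simp [decay]

theorem decay_of_lt (H : ℕ) {t n : ℕ} (h : n < t) :
    decay H t n = (1 - rate H (n + 1)) * decay H t (n + 1) :=
  Finset.prod_eq_prod_Ico_succ_bot h _

end Rates

/-! ### Functions of the observed transitions -/

section Data

variable {S A : Type*} [DecidableEq S] [DecidableEq A]

/-- The number of transitions from `(h, s, a)` in a list of observed transitions. -/
def visits (h : ℕ) (s : S) (a : A) : List (ℕ × S × A × S) → ℕ
  | [] => 0
  | (h₀, s₀, a₀, _) :: l =>
    if h = h₀ ∧ s = s₀ ∧ a = a₀ then visits h s a l + 1 else visits h s a l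

theorem visits_le_of_suffix (h : ℕ) (s : S) (a : A) {l' l : List (ℕ × S × A × S)}
    (hl : l' <:+ l) : visits h s a l' ≤ visits h s a l := by
  induction l with
  | nil => rw [List.suffix_nil.1 hl]
  | cons x l ih =>
    rcases List.suffix_cons_iff.1 hl with rfl | h'
    · exact le_rfl
    · refine (ih h').trans ?_
      obtain ⟨h₀, s₀, a₀, s'⟩ := x
      rw [visits]
      split_ifs <;> omega

/-- The running average, with learning rates `rate H`, of the deviations `f s' - μ` over the
observed transitions from `(h, s, a)` to `s'`. -/
def noise (H : ℕ) (f : S → ℝ) (μ : ℝ) (h : ℕ) (s : S) (a : A) : List (ℕ × S × A × S) → ℝ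
  | [] => 0
  | (h₀, s₀, a₀, s') :: l =>
    if h = h₀ ∧ s = s₀ ∧ a = a₀ then
      (1 - rate H (visits h s a l + 1)) * noise H f μ h s a l
        + rate H (visits h s a l + 1) * (f s' - μ)
    else noise H f μ h s a l

/-- The exponential supermartingale with parameter `lam` for the running average `noise`, stopped
at visit number `t`. -/
def expProc (H : ℕ) (f : S → ℝ) (μ : ℝ) (h : ℕ) (s : S) (a : A) (t : ℕ) (lam : ℝ) :
    List (ℕ × S × A × S) → ℝ
  | [] => 1
  | (h₀, s₀, a₀, s') :: l =>
    if (h = h₀ ∧ s = s₀ ∧ a = a₀) ∧ visits h s a l < t then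
      expProc H f μ h s a t lam l * Real.exp
        (-(lam * decay H t (visits h s a l + 1) * rate H (visits h s a l + 1) * (f s' - μ))
          - (lam * decay H t (visits h s a l + 1) * rate H (visits h s a l + 1)) ^ 2 / 2)
    else expProc H f μ h s a t lam l

theorem expProc_nonneg (H : ℕ) (f : S → ℝ) (μ : ℝ) (h : ℕ) (s : S) (a : A) (t : ℕ) (lam : ℝ)
    (l : List (ℕ × S × A × S)) : 0 ≤ expProc H f μ h s a t lam l := by
  induction l with
  | nil => simp [expProc]
  | cons x l ih =>
    obtain ⟨h₀, s₀, a₀, s'⟩ := x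
    rw [expProc]
    split_ifs
    · exact mul_nonneg ih (Real.exp_pos _).le
    · exact ih

/-- Sample j has weight `decay H t j * rate H j` in the average at visit t. With t fixed in advance
these weights are deterministic, so each factor can be normalized by Hoeffding's lemma, although the
running average itself is rescaled at every visit. -/
theorem expProc_eq (H : ℕ) (f : S → ℝ) (μ : ℝ) (h : ℕ) (s : S) (a : A) (t : ℕ) (lam : ℝ)
    (l : List (ℕ × S × A × S)) (hl : visits h s a l ≤ t) :
    expProc H f μ h s a t lam l = Real.exp
      (-(lam * decay H t (visits h s a l) * noise H f μ h s a l)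
        - (lam * decay H t (visits h s a l)) ^ 2 * rateVar H (visits h s a l) / 2) := by
  induction l with
  | nil => simp [expProc, visits, noise, rateVar]
  | cons x l ih =>
    obtain ⟨h₀, s₀, a₀, s'⟩ := x
    rw [visits] at hl
    rw [expProc, visits, noise]
    by_cases hx : h = h₀ ∧ s = s₀ ∧ a = a₀
    · rw [if_pos hx] at hl
      have hlt : visits h s a l < t := by omega
      rw [if_pos ⟨hx, hlt⟩, if_pos hx, if_pos hx, ih hlt.le, ← Real.exp_add, rateVar,
        decay_of_lt H hlt]
      congr 1
      ring
    · rw [if_neg hx] at hl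
      rw [if_neg (fun h => hx h.1), if_neg hx, if_neg hx, ih hl]

/-- The process is frozen after visit t, so a deviation at an earlier stage is still visible at the
end of the run and no maximal inequality is needed. -/
theorem expProc_eq_of_suffix (H : ℕ) (f : S → ℝ) (μ : ℝ) (h : ℕ) (s : S) (a : A) (t : ℕ)
    (lam : ℝ) {l' l : List (ℕ × S × A × S)} (hl : l' <:+ l) (ht : t ≤ visits h s a l') :
    expProc H f μ h s a t lam l = expProc H f μ h s a t lam l' := by
  induction l with
  | nil => rw [List.suffix_nil.1 hl]
  | cons x l ih =>
    rcases List.suffix_cons_iff.1 hl with rfl | h'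
    · rfl
    · obtain ⟨h₀, s₀, a₀, s'⟩ := x
      have := visits_le_of_suffix h s a h'
      rw [expProc, if_neg (by omega), ih h']

/-- With ε the deviation and variance proxy at most 2H/t, the exponent is at least lam·ε - lam²·H/t.
The choice lam = εt/(2H) maximizes this, with value ε²t/(4H) = 2ι. -/
theorem exp_le_expProc {H : ℕ} (hH : 1 ≤ H) (f : S → ℝ) (μ : ℝ) (h : ℕ) (s : S) (a : A) {t : ℕ}
    (ht : 1 ≤ t) {ι : ℝ} (hι : 0 ≤ ι) {l' l : List (ℕ × S × A × S)} (hl : l' <:+ l)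
    (hv : visits h s a l' = t) (hn : noise H f μ h s a l' < -√(8 * H * ι / t)) :
    Real.exp (2 * ι) ≤ expProc H f μ h s a t (√(8 * H * ι / t) * t / (2 * H)) l := by
  have hH' : (1 : ℝ) ≤ H := by exact_mod_cast hH
  have ht' : (1 : ℝ) ≤ t := by exact_mod_cast ht
  rw [expProc_eq_of_suffix H f μ h s a t _ hl hv.ge, expProc_eq H f μ h s a t _ l' hv.le, hv,
    decay_self, mul_one, Real.exp_le_exp]
  set ε := √(8 * H * ι / t) with hε
  have hε0 : 0 ≤ ε := Real.sqrt_nonneg _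
  have hε2 : ε ^ 2 * t = 8 * H * ι := by
    rw [hε, Real.sq_sqrt (by positivity)]
    field_simp
  set lam := ε * t / (2 * H) with hlam
  have hlam0 : 0 ≤ lam := by positivity
  have h1 : lam * ε ≤ -(lam * noise H f μ h s a l') := by
    have := mul_le_mul_of_nonneg_left hn.le hlam0
    linarith
  have h2 : lam ^ 2 * rateVar H t ≤ lam * ε := by
    have hr := rateVar_le hH t
    have : lam ^ 2 * rateVar H t = lam * ε / (2 * H) * (t * rateVar H t) := by
      rw [hlam]; ring
    rw [this]
    calc lam * ε / (2 * H) * (t * rateVar H t) ≤ lam * ε / (2 * H) * (2 * H) := by gcongr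
      _ = lam * ε := by field_simp
  have h3 : lam * ε = 4 * ι := by
    rw [hlam]
    field_simp
    linarith
  linarith

section Run

variable [Fintype A] [Nonempty A]

/-- The one-step inequality is assumed for every state and action, so the choice of actions, however
adaptive, plays no role. -/
theorem expect_runSteps_le (M : EpisodicMDP S A) (c L : ℝ) (g : ActionRule S A)
    {F : List (ℕ × S × A × S) → ℝ≥0∞}
    (hF : ∀ h s a l, expect (M.P h s a) (fun s' => F ((h, s, a, s') :: l)) ≤ F l)
    (n h : ℕ) (s : S) (m : Memory S A) :
    expect (runSteps M c L g n h s m) (fun m => F m.data) ≤ F m.data := by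
  induction n generalizing h s m with
  | zero => rw [runSteps, expect_pure]
  | succ n ih =>
    rw [runSteps, expect_bind]
    refine expect_le_of_forall_le _ fun a => ?_
    rw [expect_bind]
    exact (expect_mono _ fun s' => ih (h + 1) s' _).trans (hF h s a m.data)

theorem expect_runEpisodes_le (M : EpisodicMDP S A) (c L : ℝ) (g : ActionRule S A)
    {F : List (ℕ × S × A × S) → ℝ≥0∞}
    (hF : ∀ h s a l, expect (M.P h s a) (fun s' => F ((h, s, a, s') :: l)) ≤ F l) (k : ℕ) :
    expect (runEpisodes M c L g k) (fun m => F m.data) ≤ F [] := by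
  induction k with
  | zero => rw [runEpisodes, expect_pure]; rfl
  | succ k ih =>
    rw [runEpisodes, expect_bind]
    exact (expect_mono _ fun m => expect_runSteps_le M c L g hF _ _ _ m).trans ih

end Run

variable [Fintype S]

theorem expect_expProc_cons_le (M : EpisodicMDP S A) {f : S → ℝ} (h0 : ∀ x, 0 ≤ f x)
    (h1 : ∀ x, f x ≤ 1) (h : ℕ) (s : S) (a : A) (t : ℕ) (lam : ℝ) (h₀ : ℕ) (s₀ : S) (a₀ : A)
    (l : List (ℕ × S × A × S)) :
    expect (M.P h₀ s₀ a₀) (fun s' => ENNReal.ofReal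
      (expProc M.H f (∑ x, (M.P h s a x).toReal * f x) h s a t lam ((h₀, s₀, a₀, s') :: l)))
    ≤ ENNReal.ofReal (expProc M.H f (∑ x, (M.P h s a x).toReal * f x) h s a t lam l) := by
  simp only [expProc]
  split_ifs with hx
  · obtain ⟨⟨rfl, rfl, rfl⟩, -⟩ := hx
    rw [expect_ofReal]
    · refine ENNReal.ofReal_le_ofReal ?_
      have hZ := expProc_nonneg M.H f (∑ x, (M.P h s a x).toReal * f x) h s a t lam l
      simp_rw [mul_left_comm _ (expProc _ _ _ _ _ _ _ _ _)]
      rw [← Finset.mul_sum]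
      exact mul_le_of_le_one_right hZ (sum_mul_exp_le (M.P h s a) f h0 h1 _)
    · exact fun s' => mul_nonneg (expProc_nonneg _ _ _ _ _ _ _ _ _) (Real.exp_pos _).le
  · rw [expect_const]

/-- A uniform lower deviation bound for the running averages of reachabilities `δ_{h'+1,h}(·, s)`
along a list of transitions and all its earlier stages; at most `T` visits are considered. -/
def ConcentratedData (M : EpisodicMDP S A) (T : ℕ) (ι : ℝ) (l : List (ℕ × S × A × S)) : Prop :=
  ∀ l', l' <:+ l → ∀ h' s' a h s, 1 ≤ h' → h' < h → h ≤ M.H →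
    1 ≤ visits h' s' a l' → visits h' s' a l' ≤ T →
    -√(8 * M.H * ι / visits h' s' a l') ≤
      noise M.H (fun x => relReach M (h' + 1) h x s) (meanReach M h' s' a h s) h' s' a l'

/-- Union bound over source triples, target pairs and visit numbers; Markov's inequality for the
final value of each supermartingale gives exp(-2ι). -/
theorem toOuterMeasure_not_concentratedData_le [Fintype A] [Nonempty A]
    (M : EpisodicMDP S A) (c L : ℝ) (g : ActionRule S A) (k : ℕ) {T : ℕ} {ι : ℝ} (hι : 0 ≤ ι) :
    (runEpisodes M c L g k).toOuterMeasure {m | ¬ ConcentratedData M T ι m.data}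
      ≤ (M.H * Fintype.card S * Fintype.card A * (M.H * Fintype.card S) * T : ℕ)
        * ENNReal.ofReal (Real.exp (-(2 * ι))) := by
  set p := runEpisodes M c L g k
  -- Steps and visit numbers start at 1, while `Fin` starts at 0; hence the shifts.
  let bad : (Fin M.H × S × A) × (Fin M.H × S) × Fin T → Set (Memory S A) := fun i =>
    {m | Real.exp (2 * ι) ≤ expProc M.H
      (fun x => relReach M (i.1.1 + 1 + 1) (i.2.1.1 + 1) x i.2.1.2)
      (meanReach M (i.1.1 + 1) i.1.2.1 i.1.2.2 (i.2.1.1 + 1) i.2.1.2) (i.1.1 + 1) i.1.2.1 i.1.2.2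
      (i.2.2 + 1) (√(8 * M.H * ι / ((i.2.2 : ℕ) + 1 : ℕ)) * ((i.2.2 : ℕ) + 1 : ℕ) / (2 * M.H))
      m.data}
  have hsub : {m : Memory S A | ¬ ConcentratedData M T ι m.data} ⊆ ⋃ i, bad i := by
    intro m hm
    simp only [Set.mem_ofPred_eq, ConcentratedData] at hm
    push Not at hm
    obtain ⟨l', hl, h', s', a, h, s, h1, h2, h3, h4, h5, h6⟩ := hm
    refine Set.mem_iUnion.2 ⟨((⟨h' - 1, by omega⟩, s', a), (⟨h - 1, by omega⟩, s),
      ⟨visits h' s' a l' - 1, by omega⟩), ?_⟩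
    have e1 : h' - 1 + 1 = h' := by omega
    have e2 : h - 1 + 1 = h := by omega
    have e3 : visits h' s' a l' - 1 + 1 = visits h' s' a l' := by omega
    simp only [bad, Set.mem_ofPred_eq, e1, e2, e3]
    exact exp_le_expProc (by omega) _ _ _ _ _ h4 hι hl rfl h6
  calc p.toOuterMeasure {m | ¬ ConcentratedData M T ι m.data}
      ≤ p.toOuterMeasure (⋃ i, bad i) := MeasureTheory.measure_mono hsub
    _ ≤ ∑ i, p.toOuterMeasure (bad i) := MeasureTheory.measure_iUnion_fintype_le _ _
    _ ≤ ∑ _i : (Fin M.H × S × A) × (Fin M.H × S) × Fin T,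
          ENNReal.ofReal (Real.exp (-(2 * ι))) := by
        refine Finset.sum_le_sum fun i _ => ?_
        obtain ⟨⟨h', s', a⟩, ⟨h, s⟩, t⟩ := i
        refine toOuterMeasure_le_of_expect_le_one p (fun m => ENNReal.ofReal (expProc M.H
          (fun x => relReach M (h' + 1 + 1) (h + 1) x s) (meanReach M (h' + 1) s' a (h + 1) s)
          (h' + 1) s' a (t + 1)
          (√(8 * M.H * ι / ((t : ℕ) + 1 : ℕ)) * ((t : ℕ) + 1 : ℕ) / (2 * M.H)) m.data)) ?_ ?_
        · refine (expect_runEpisodes_le M c L g (F := fun l => ENNReal.ofReal (expProc M.H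
            (fun x => relReach M (h' + 1 + 1) (h + 1) x s) (meanReach M (h' + 1) s' a (h + 1) s)
            (h' + 1) s' a (t + 1) _ l)) (fun h₀ s₀ a₀ l => ?_) k).trans ?_
          · exact expect_expProc_cons_le M (fun x => relReach_nonneg M _ _ x s)
              (fun x => relReach_le_one M _ _ x s) _ _ _ _ _ _ _ _ l
          · simp [expProc]
        · intro m hm
          rw [← ENNReal.ofReal_mul (Real.exp_pos _).le, ENNReal.one_le_ofReal]
          calc (1 : ℝ) = Real.exp (-(2 * ι)) * Real.exp (2 * ι) := by
                rw [← Real.exp_add]; simp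
            _ ≤ _ := mul_le_mul_of_nonneg_left hm (Real.exp_pos _).le
    _ = _ := by
        rw [Finset.sum_const, nsmul_eq_mul, Finset.card_univ]
        simp only [Fintype.card_prod, Fintype.card_fin]
        congr 2
        ring

end Data

/-! ### The memory as a function of the observed transitions -/

theorem bonus_nonneg {c : ℝ} (hc : 0 ≤ c) (L : ℝ) (H t : ℕ) : 0 ≤ bonus c L H t :=
  mul_nonneg hc (Real.sqrt_nonneg _)

theorem bonus_anti {c L : ℝ} (hc : 0 ≤ c) (hL : 0 ≤ L) (H : ℕ) {t t' : ℕ} (ht : 1 ≤ t)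
    (htt : t ≤ t') : bonus c L H t' ≤ bonus c L H t := by
  have h1 : (1 : ℝ) ≤ t := by exact_mod_cast ht
  unfold bonus
  gcongr

theorem vbar_nonneg {S A : Type*} [Fintype A] [Nonempty A] (H : ℕ) {m : Memory S A}
    (hm : ∀ h s a, 0 ≤ m.Q h s a) (h : ℕ) (s : S) :
    0 ≤ vbar H m h s := by
  unfold vbar
  split_ifs
  · refine le_min H.cast_nonneg ?_
    obtain ⟨a⟩ := ‹Nonempty A›
    exact (hm h s a).trans (Finset.le_sup' (m.Q h s) (Finset.mem_univ a))
  · exact le_rfl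

/-- The lower bound for `Q_h(s,a)` that is guaranteed by at most `n` visits, truncated at `H`. -/
def level (c L : ℝ) (H n : ℕ) : ℝ := if n = 0 then H else min (H : ℝ) (2 * bonus c L H n)

theorem level_le (c L : ℝ) (H n : ℕ) : level c L H n ≤ H := by
  unfold level
  split_ifs
  · exact le_rfl
  · exact min_le_left _ _

theorem level_nonneg {c : ℝ} (hc : 0 ≤ c) (L : ℝ) (H n : ℕ) : 0 ≤ level c L H n := by
  unfold level
  split_ifs
  · exact H.cast_nonneg
  · exact le_min H.cast_nonneg (mul_nonneg zero_le_two (bonus_nonneg hc L H n))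

section Replay

variable {S A : Type*} [DecidableEq S] [DecidableEq A] [Fintype A] [Nonempty A]

/-- The memory that results from a list of observed transitions, the most recent one first. -/
def replay (H : ℕ) (c L : ℝ) : List (ℕ × S × A × S) → Memory S A
  | [] => initMemory S A H
  | (h, s, a, s') :: l => (replay H c L l).update H c L h s a s'

variable (H : ℕ) (c L : ℝ)

theorem replay_count (h : ℕ) (s : S) (a : A) (l : List (ℕ × S × A × S)) :
    (replay H c L l).count h s a = visits h s a l := by
  induction l generalizing h s a with
  | nil => rfl
  | cons x l ih =>
    obtain ⟨h₀, s₀, a₀, s'⟩ := x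
    simp only [replay, visits, Memory.update, ih]
    split_ifs with hx
    · obtain ⟨rfl, rfl, rfl⟩ := hx; rfl
    · rfl

theorem replay_Q_cons_self (h : ℕ) (s : S) (a : A) (s' : S) (l : List (ℕ × S × A × S)) :
    (replay H c L ((h, s, a, s') :: l)).Q h s a =
      (1 - rate H (visits h s a l + 1)) * (replay H c L l).Q h s a
        + rate H (visits h s a l + 1) * (vbar H (replay H c L l) (h + 1) s'
          + 2 * bonus c L H (visits h s a l + 1)) := by
  simp [replay, Memory.update, replay_count]

theorem replay_Q_cons_of_not {h h₀ : ℕ} {s s₀ : S} {a a₀ : A}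
    (hx : ¬ (h = h₀ ∧ s = s₀ ∧ a = a₀)) (s' : S) (l : List (ℕ × S × A × S)) :
    (replay H c L ((h₀, s₀, a₀, s') :: l)).Q h s a = (replay H c L l).Q h s a := by
  simp only [replay, Memory.update, if_neg hx]

theorem vbar_replay_cons_of_ne {h h₀ : ℕ} (hh : h ≠ h₀) (s s₀ : S) (a₀ : A) (s' : S)
    (l : List (ℕ × S × A × S)) :
    vbar H (replay H c L ((h₀, s₀, a₀, s') :: l)) h s = vbar H (replay H c L l) h s := by
  have : (replay H c L ((h₀, s₀, a₀, s') :: l)).Q h s = (replay H c L l).Q h s :=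
    funext fun a => replay_Q_cons_of_not H c L (fun h => hh h.1) s' l
  unfold vbar
  rw [this]

variable {c L}

theorem replay_Q_nonneg (hc : 0 ≤ c) (l : List (ℕ × S × A × S)) (h : ℕ) (s : S) (a : A) :
    0 ≤ (replay H c L l).Q h s a := by
  induction l generalizing h s a with
  | nil => exact H.cast_nonneg
  | cons x l ih =>
    obtain ⟨h₀, s₀, a₀, s'⟩ := x
    by_cases hx : h = h₀ ∧ s = s₀ ∧ a = a₀
    · obtain ⟨rfl, rfl, rfl⟩ := hx
      rw [replay_Q_cons_self]
      exact add_nonneg (mul_nonneg (one_sub_rate_succ_nonneg H _) (ih h s a))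
        (mul_nonneg (rate_nonneg H _) (add_nonneg (vbar_nonneg H ih _ _)
          (mul_nonneg zero_le_two (bonus_nonneg hc L H _))))
    · rw [replay_Q_cons_of_not H c L hx]
      exact ih h s a

theorem replay_Q_of_visits_eq_zero {h : ℕ} {s : S} {a : A} {l : List (ℕ × S × A × S)}
    (hl : visits h s a l = 0) : (replay H c L l).Q h s a = H := by
  induction l with
  | nil => rfl
  | cons x l ih =>
    obtain ⟨h₀, s₀, a₀, s'⟩ := x
    rw [visits] at hl
    split_ifs at hl with hx
    rw [replay_Q_cons_of_not H c L hx, ih hl]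

/-- An update is a convex combination of the old value, at least twice an earlier and hence larger
bonus, and a target containing the new bonus twice. -/
theorem two_bonus_le_replay_Q (hc : 0 ≤ c) (hL : 0 ≤ L) {h : ℕ} {s : S} {a : A}
    {l : List (ℕ × S × A × S)} (hl : 1 ≤ visits h s a l) :
    2 * bonus c L H (visits h s a l) ≤ (replay H c L l).Q h s a := by
  induction l with
  | nil => simp [visits] at hl
  | cons x l ih =>
    obtain ⟨h₀, s₀, a₀, s'⟩ := x
    by_cases hx : h = h₀ ∧ s = s₀ ∧ a = a₀
    · rw [visits, if_pos hx]
      obtain ⟨rfl, rfl, rfl⟩ := hx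
      rw [replay_Q_cons_self]
      have hv := vbar_nonneg H (replay_Q_nonneg H hc l (L := L)) (h + 1) s'
      rcases Nat.eq_zero_or_pos (visits h s a l) with h0 | h0
      · rw [h0, zero_add, rate_one]; linarith
      · have h1 := ih h0
        have h2 := bonus_anti hc hL H h0 (Nat.le_succ _)
        have h3 := one_sub_rate_succ_nonneg H (visits h s a l)
        have h4 := rate_nonneg H (visits h s a l + 1)
        set r := rate H (visits h s a l + 1)
        set b := bonus c L H (visits h s a l + 1)
        calc 2 * b = (1 - r) * (2 * b) + r * (2 * b) := by ring
          _ ≤ _ := by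
            refine add_le_add (mul_le_mul_of_nonneg_left ?_ h3)
              (mul_le_mul_of_nonneg_left (by linarith) h4)
            exact le_trans (by linarith [show bonus c L H (visits h s a l).succ = b from rfl]) h1
    · rw [replay_Q_cons_of_not H c L hx]
      rw [visits, if_neg hx] at hl ⊢
      exact ih hl

theorem level_le_replay_Q (hc : 0 ≤ c) (hL : 0 ≤ L) {h : ℕ} {s : S} {a : A} {n : ℕ}
    {l : List (ℕ × S × A × S)} (hl : visits h s a l ≤ n) :
    level c L H n ≤ (replay H c L l).Q h s a := by
  rcases Nat.eq_zero_or_pos (visits h s a l) with h0 | h0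
  · rw [replay_Q_of_visits_eq_zero H h0]
    exact level_le c L H n
  · rw [level, if_neg (by omega)]
    refine (min_le_right _ _).trans ?_
    have := bonus_anti hc hL H h0 hl
    exact le_trans (by linarith) (two_bonus_le_replay_Q H hc hL h0)

end Replay

/-! ### Optimism -/

theorem ConcentratedData.of_suffix {S A : Type*} [DecidableEq S] [DecidableEq A] [Fintype S]
    {M : EpisodicMDP S A} {T : ℕ} {ι : ℝ}
    {l l' : List (ℕ × S × A × S)} (hl : ConcentratedData M T ι l) (h : l' <:+ l) :
    ConcentratedData M T ι l' :=
  fun l'' h'' => hl l'' (h''.trans h)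

/-- The bonus dominates the deviations in `ConcentratedData`. -/
theorem mul_sqrt_le_two_bonus {H : ℕ} {ι L B : ℝ} (hι : 0 ≤ ι) (hιL : ι ≤ L)
    (hBH : B ≤ H) (t : ℕ) :
    B * √(8 * H * ι / t) ≤ 2 * bonus 2 L H t := by
  -- The left side is √(8 H³ ι / t), and 8 ≤ 4²: bonus constant 2 suffices.
  have h1 : √(8 * H * ι / t) * H ≤ 4 * √((H : ℝ) ^ 3 * L / t) := by
    have e1 : (H : ℝ) = √((H : ℝ) ^ 2) := (Real.sqrt_sq H.cast_nonneg).symm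
    have e2 : (4 : ℝ) = √(4 ^ 2) := (Real.sqrt_sq (by norm_num)).symm
    rw [e2]
    conv_lhs => rw [mul_comm]; arg 1; rw [e1]
    rw [← Real.sqrt_mul (by positivity), ← Real.sqrt_mul (by positivity)]
    refine Real.sqrt_le_sqrt ?_
    have h2 : (H : ℝ) ^ 3 * ι / t ≤ (H : ℝ) ^ 3 * L / t := by gcongr
    have h3 : 0 ≤ (H : ℝ) ^ 3 * ι / t := by positivity
    calc (H : ℝ) ^ 2 * (8 * H * ι / t) = 8 * ((H : ℝ) ^ 3 * ι / t) := by ring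
      _ ≤ _ := by linarith
  unfold bonus
  calc B * √(8 * H * ι / t) ≤ H * √(8 * H * ι / t) := by gcongr
    _ ≤ _ := by linarith

section Optimism

variable {S A : Type*} [DecidableEq S] [Fintype S] [Fintype A] [Nonempty A]
  (M : EpisodicMDP S A)

/-- Passes from Q to V: before step h by the Bellman inequality, at step h because B is already
collected in s and reachability vanishes elsewhere. -/
theorem mul_relReach_le_vbar {m : Memory S A} (hm : ∀ h s a, 0 ≤ m.Q h s a) {B : ℝ}
    (hB0 : 0 ≤ B) (hBH : B ≤ M.H) {h : ℕ} {s : S} {a : A} (hh : h ≤ M.H) (hQ : B ≤ m.Q h s a)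
    (hQ' : ∀ h' s' a', 1 ≤ h' → h' < h → B * meanReach M h' s' a' h s ≤ m.Q h' s' a')
    {h' : ℕ} (h1 : 1 ≤ h') (h2 : h' ≤ h) (s' : S) :
    B * relReach M h' h s' s ≤ vbar M.H m h' s' := by
  rw [vbar, if_pos (h2.trans hh)]
  refine le_min ((mul_le_of_le_one_right hB0 (relReach_le_one M _ _ _ _)).trans hBH) ?_
  have hsup : ∀ b, m.Q h' s' b ≤ Finset.univ.sup' Finset.univ_nonempty (m.Q h' s') := fun b =>
    Finset.le_sup' (m.Q h' s') (Finset.mem_univ b)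
  have hsup0 : 0 ≤ Finset.univ.sup' Finset.univ_nonempty (m.Q h' s') :=
    (hm h' s' a).trans (hsup a)
  rcases h2.lt_or_eq with h2 | rfl
  · rcases hB0.eq_or_lt with rfl | hB
    · simpa using hsup0
    · rw [← le_div_iff₀' hB]
      refine relReach_le_of_meanReach_le M h2 (by positivity) fun b => ?_
      rw [le_div_iff₀' hB]
      exact (hQ' h' s' b h1 h2).trans (hsup b)
  · have hr := relReach_self_le M h' s' s
    split_ifs at hr with hs
    · subst hs
      exact (mul_le_of_le_one_right hB0 hr).trans (hQ.trans (hsup a))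
    · exact (mul_nonpos_of_nonneg_of_nonpos hB0 hr).trans hsup0

variable [DecidableEq A]

/-- A lower bound for `Q_{h'}(s',a')` in terms of the reachability of `s` at step `h`. -/
def NoisyOptimism (L B : ℝ) (h : ℕ) (s : S) (l : List (ℕ × S × A × S)) : Prop :=
  ∀ h' s' a', 1 ≤ h' → h' < h → 1 ≤ visits h' s' a' l →
    B * (meanReach M h' s' a' h s
      + noise M.H (fun x => relReach M (h' + 1) h x s) (meanReach M h' s' a' h s) h' s' a' l)
      + 2 * bonus 2 L M.H (visits h' s' a' l) ≤ (replay M.H 2 L l).Q h' s' a'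

theorem NoisyOptimism.mul_relReach_le {M : EpisodicMDP S A} {T : ℕ} {ι L B : ℝ} (hι : 0 ≤ ι)
    (hιL : ι ≤ L) (hB0 : 0 ≤ B) (hBH : B ≤ M.H) {h : ℕ} {s : S} {a : A} (hh : h ≤ M.H)
    {l : List (ℕ × S × A × S)} (hopt : NoisyOptimism M L B h s l) (hl : ConcentratedData M T ι l)
    (hT : ∀ i x b, 1 ≤ i → i ≤ M.H → visits i x b l ≤ T)
    (hQ : B ≤ (replay M.H 2 L l).Q h s a) {h' : ℕ} (h1 : 1 ≤ h') (h2 : h' ≤ h) (s' : S) :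
    B * relReach M h' h s' s ≤ vbar M.H (replay M.H 2 L l) h' s' := by
  refine mul_relReach_le_vbar M (replay_Q_nonneg M.H zero_le_two l) hB0 hBH hh hQ ?_ h1 h2 s'
  intro i x b hi1 hi2
  rcases Nat.eq_zero_or_pos (visits i x b l) with h0 | h0
  · rw [replay_Q_of_visits_eq_zero M.H h0]
    exact (mul_le_of_le_one_right hB0 (meanReach_le_one M _ _ _ _ _)).trans hBH
  · have e1 := hopt i x b hi1 hi2 h0
    have e2 := hl l List.suffix_rfl i x b h s hi1 hi2 hh h0 (hT i x b hi1 (hi2.le.trans hh))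
    have e3 := mul_sqrt_le_two_bonus hι hιL hBH (visits i x b l)
    have e4 := mul_le_mul_of_nonneg_left e2 hB0
    linarith

/-- Keeping the noise explicit makes the induction close: Q and `noise` obey the same averaging
recursion, and the next value is at least B times reachability by the previous stage. The noise is
traded for the bonus only when passing to V. -/
theorem noisyOptimism {T : ℕ} {ι L B : ℝ} (hι : 0 ≤ ι) (hιL : ι ≤ L)
    (hB0 : 0 ≤ B) (hBH : B ≤ M.H) {h : ℕ} {s : S} {a : A} (hh : h ≤ M.H)
    {l : List (ℕ × S × A × S)} (hl : ConcentratedData M T ι l)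
    (hT : ∀ i x b, 1 ≤ i → i ≤ M.H → visits i x b l ≤ T)
    (hQ : ∀ l', l' <:+ l → B ≤ (replay M.H 2 L l').Q h s a) : NoisyOptimism M L B h s l := by
  induction l with
  | nil => intro h' s' a' _ _ h0; simp [visits] at h0
  | cons y l ih =>
    have hsuf : l <:+ y :: l := List.suffix_cons y l
    have hl' := hl.of_suffix hsuf
    have hT' : ∀ i x b, 1 ≤ i → i ≤ M.H → visits i x b l ≤ T := fun i x b h1 h2 =>
      (visits_le_of_suffix i x b hsuf).trans (hT i x b h1 h2)
    have hopt := ih hl' hT' fun l' h' => hQ l' (h'.trans hsuf)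
    obtain ⟨h₀, s₀, a₀, y'⟩ := y
    intro h' s' a' h1 h2 h0
    by_cases hx : h' = h₀ ∧ s' = s₀ ∧ a' = a₀
    · rw [noise, if_pos hx, visits, if_pos hx]
      obtain ⟨rfl, rfl, rfl⟩ := hx
      rw [replay_Q_cons_self]
      have hV := hopt.mul_relReach_le hι hιL hB0 hBH hh hl' hT' (hQ l hsuf)
        (h' := h' + 1) (by omega) (by omega) y'
      have hr1 := one_sub_rate_succ_nonneg M.H (visits h' s' a' l)
      have hr := rate_nonneg M.H (visits h' s' a' l + 1)
      rcases Nat.eq_zero_or_pos (visits h' s' a' l) with hz | hz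
      · rw [hz, zero_add, rate_one]
        linarith
      · have e1 := hopt h' s' a' h1 h2 hz
        have e2 := bonus_anti zero_le_two (hι.trans hιL) M.H hz (Nat.le_add_right _ 1)
        set r := rate M.H (visits h' s' a' l + 1)
        set b := bonus 2 L M.H (visits h' s' a' l + 1)
        set w := noise M.H (fun x => relReach M (h' + 1) h x s) (meanReach M h' s' a' h s)
          h' s' a' l
        have e3 := mul_le_mul_of_nonneg_left (e1.trans' (add_le_add_right
          (mul_le_mul_of_nonneg_left e2 zero_le_two) _)) hr1
        have e4 := mul_le_mul_of_nonneg_left hV hr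
        linarith
    · rw [replay_Q_cons_of_not M.H 2 L hx]
      rw [visits, if_neg hx] at h0
      rw [noise, if_neg hx, visits, if_neg hx]
      exact hopt h' s' a' h1 h2 h0

/-- The level is that of the final list `l`, the value that of any earlier stage `l'`: counts only
grow, so the level holds all along. -/
theorem level_mul_reach_le_vbar {T : ℕ} {ι L : ℝ} (hι : 0 ≤ ι) (hιL : ι ≤ L)
    {h : ℕ} (s : S) (a : A) (h1 : 1 ≤ h) (hh : h ≤ M.H)
    {l l' : List (ℕ × S × A × S)} (hl : ConcentratedData M T ι l)
    (hT : ∀ i x b, 1 ≤ i → i ≤ M.H → visits i x b l ≤ T) (hsuf : l' <:+ l) :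
    level 2 L M.H (visits h s a l) * reach M h s ≤ vbar M.H (replay M.H 2 L l') 1 M.s₁ := by
  have hQ : ∀ l'', l'' <:+ l' →
      level 2 L M.H (visits h s a l) ≤ (replay M.H 2 L l'').Q h s a := fun l'' h'' =>
    level_le_replay_Q M.H zero_le_two (hι.trans hιL) (visits_le_of_suffix h s a (h''.trans hsuf))
  have hT' : ∀ i x b, 1 ≤ i → i ≤ M.H → visits i x b l' ≤ T := fun i x b h1 h2 =>
    (visits_le_of_suffix i x b hsuf).trans (hT i x b h1 h2)
  have hB0 := level_nonneg zero_le_two L M.H (visits h s a l)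
  have hBH := level_le 2 L M.H (visits h s a l)
  exact (noisyOptimism M hι hιL hB0 hBH hh (hl.of_suffix hsuf) hT' hQ).mul_relReach_le hι hιL
    hB0 hBH hh (hl.of_suffix hsuf) hT' (hQ l' List.suffix_rfl) le_rfl h1 M.s₁

end Optimism

/-! ### The sum of the pseudo-values along the run -/

theorem sum_eq_sum_add_of_eq_off {α : Type*} [Fintype α] {φ ψ : α → ℝ} (x₀ : α)
    (h : ∀ x, x ≠ x₀ → φ x = ψ x) : ∑ x, φ x = ∑ x, ψ x + (φ x₀ - ψ x₀) := by
  have : ∑ x, (φ x - ψ x) = φ x₀ - ψ x₀ :=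
    Finset.sum_eq_single x₀ (fun x _ hx => by rw [h x hx, sub_self])
      (fun hx => absurd (Finset.mem_univ x₀) hx)
  rw [← this, Finset.sum_sub_distrib]
  ring

section Sums

variable {S A : Type*} [DecidableEq S] [DecidableEq A]

/-- The sum of the bonuses at step `i`. -/
def sumBonus (H : ℕ) (c L : ℝ) (i : ℕ) : List (ℕ × S × A × S) → ℝ
  | [] => 0
  | (h, s, a, _) :: l =>
    if h = i then sumBonus H c L i l + bonus c L H (visits h s a l + 1) else sumBonus H c L i l

theorem visits_cons_ne (i : ℕ) {h : ℕ} {s : S} {a : A} {x : S × A} (hx : x ≠ (s, a)) (s' : S)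
    (l : List (ℕ × S × A × S)) :
    visits i x.1 x.2 ((h, s, a, s') :: l) = visits i x.1 x.2 l := by
  rw [visits, if_neg]
  rintro ⟨-, h1, h2⟩
  exact hx (Prod.ext h1 h2)

theorem visits_cons_self (h : ℕ) (s : S) (a : A) (s' : S) (l : List (ℕ × S × A × S)) :
    visits h s a ((h, s, a, s') :: l) = visits h s a l + 1 := by
  rw [visits, if_pos ⟨rfl, rfl, rfl⟩]

theorem visits_cons_of_step_ne {i h : ℕ} (hi : h ≠ i) (s₀ : S) (a₀ : A) (s : S) (a : A) (s' : S)
    (l : List (ℕ × S × A × S)) :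
    visits i s₀ a₀ ((h, s, a, s') :: l) = visits i s₀ a₀ l := by
  rw [visits, if_neg fun h => hi h.1.symm]

variable [Fintype S] [Fintype A]

theorem sum_visits_cons (i h : ℕ) (s : S) (a : A) (s' : S) (l : List (ℕ × S × A × S)) :
    ∑ x : S × A, (visits i x.1 x.2 ((h, s, a, s') :: l) : ℝ) =
      ∑ x : S × A, (visits i x.1 x.2 l : ℝ) + if h = i then 1 else 0 := by
  split_ifs with hi
  · subst hi
    rw [sum_eq_sum_add_of_eq_off (s, a) fun x hx => by rw [visits_cons_ne h hx]]
    rw [visits_cons_self]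
    push_cast
    ring
  · simp only [visits_cons_of_step_ne hi, add_zero]

theorem inv_sqrt_succ_le (n : ℕ) : 1 / √((n : ℝ) + 1) ≤ 2 * (√((n : ℝ) + 1) - √n) := by
  have h1 : 0 < √((n : ℝ) + 1) := Real.sqrt_pos.2 (by positivity)
  have h2 : √(n : ℝ) ^ 2 = n := Real.sq_sqrt n.cast_nonneg
  have h3 : √((n : ℝ) + 1) ^ 2 = n + 1 := Real.sq_sqrt (by positivity)
  rw [div_le_iff₀ h1]
  nlinarith [sq_nonneg (√((n : ℝ) + 1) - √n)]

theorem bonus_succ_le {c L : ℝ} (hc : 0 ≤ c) (hL : 0 ≤ L) (H n : ℕ) :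
    bonus c L H (n + 1) ≤ 2 * c * √((H : ℝ) ^ 3 * L) * (√((n + 1 : ℕ) : ℝ) - √n) := by
  unfold bonus
  rw [Real.sqrt_div (by positivity)]
  push_cast
  calc c * (√((H : ℝ) ^ 3 * L) / √((n : ℝ) + 1))
      = c * √((H : ℝ) ^ 3 * L) * (1 / √((n : ℝ) + 1)) := by ring
    _ ≤ c * √((H : ℝ) ^ 3 * L) * (2 * (√((n : ℝ) + 1) - √n)) := by
        gcongr; exact inv_sqrt_succ_le n
    _ = _ := by ring

theorem sumBonus_le_sum_sqrt {c L : ℝ} (hc : 0 ≤ c) (hL : 0 ≤ L) (H i : ℕ)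
    (l : List (ℕ × S × A × S)) :
    sumBonus H c L i l ≤
      2 * c * √((H : ℝ) ^ 3 * L) * ∑ x : S × A, √(visits i x.1 x.2 l : ℝ) := by
  induction l with
  | nil => simp [sumBonus, visits]
  | cons y l ih =>
    obtain ⟨h, s, a, s'⟩ := y
    rw [sumBonus]
    split_ifs with hi
    · subst hi
      rw [sum_eq_sum_add_of_eq_off (ψ := fun x : S × A => √(visits h x.1 x.2 l : ℝ)) (s, a)
        fun x hx => by rw [visits_cons_ne h hx], visits_cons_self, mul_add]
      exact add_le_add ih (bonus_succ_le hc hL H _)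
    · simpa only [visits_cons_of_step_ne hi] using ih

/-- Cauchy–Schwarz over the SA pairs, after the sums of 1/√t telescope to square roots of the
counts. -/
theorem sumBonus_le {c L : ℝ} (hc : 0 ≤ c) (hL : 0 ≤ L) (H i : ℕ)
    (l : List (ℕ × S × A × S)) {K : ℝ} (hK : ∑ x : S × A, (visits i x.1 x.2 l : ℝ) = K) :
    sumBonus H c L i l ≤
      2 * c * √((H : ℝ) ^ 3 * L) * √(Fintype.card S * Fintype.card A * K) := by
  refine (sumBonus_le_sum_sqrt hc hL H i l).trans ?_
  refine mul_le_mul_of_nonneg_left ?_ (by positivity)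
  refine Real.le_sqrt_of_sq_le ?_
  have := sq_sum_le_card_mul_sum_sq (s := (Finset.univ : Finset (S × A)))
    (f := fun x => √(visits i x.1 x.2 l : ℝ))
  simp only [Real.sq_sqrt (Nat.cast_nonneg _), Finset.card_univ, Fintype.card_prod] at this
  rw [hK] at this
  push_cast at this
  exact this

end Sums

/-! ### Potential argument and recursion over the steps -/

section Values

variable {S A : Type*} [DecidableEq S] [DecidableEq A] [Fintype A] [Nonempty A]

/-- The sum of `V_i(s)`, with the memory at that time, over all transitions at step `i`
from a state `s`. -/
def sumValue (H : ℕ) (c L : ℝ) (i : ℕ) : List (ℕ × S × A × S) → ℝ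
  | [] => 0
  | (h, s, _, _) :: l =>
    if h = i then sumValue H c L i l + vbar H (replay H c L l) h s else sumValue H c L i l

/-- The sum of `V_{i+1}(s')`, with the memory at that time, over all transitions at step `i`
to a state `s'`. -/
def sumNextValue (H : ℕ) (c L : ℝ) (i : ℕ) : List (ℕ × S × A × S) → ℝ
  | [] => 0
  | (h, _, _, s') :: l =>
    if h = i then sumNextValue H c L i l + vbar H (replay H c L l) (h + 1) s'
    else sumNextValue H c L i l

/-- All actions in a list of transitions were greedy when they were taken. -/
def GreedyData (H : ℕ) (c L : ℝ) : List (ℕ × S × A × S) → Prop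
  | [] => True
  | (h, s, a, _) :: l =>
    (∀ b, (replay H c L l).Q h s b ≤ (replay H c L l).Q h s a) ∧ GreedyData H c L l

theorem sumNextValue_last (H : ℕ) (c L : ℝ) (l : List (ℕ × S × A × S)) :
    sumNextValue H c L H l = 0 := by
  induction l with
  | nil => rfl
  | cons y l ih =>
    obtain ⟨h, s, a, s'⟩ := y
    rw [sumNextValue]
    split_ifs with hi
    · rw [ih, vbar, if_neg (by omega), add_zero]
    · exact ih

variable [Fintype S]

/-- The potential is Σ (1 + n/H) Q. Since (1 + (n+1)/H)(1 - α_{n+1}) = n/H and (1 + (n+1)/H) α_{n+1}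
= 1 + 1/H, an update lowers it by Q, which is at least V as the action is greedy, and adds 1 + 1/H
times the target. It starts at SAH. -/
theorem sumValue_add_sum_le {H : ℕ} (hH : 1 ≤ H) (c L : ℝ) {l : List (ℕ × S × A × S)}
    (hg : GreedyData H c L l) (i : ℕ) (hi : i ≤ H) :
    sumValue H c L i l
        + ∑ x : S × A, (1 + (visits i x.1 x.2 l : ℝ) / H) * (replay H c L l).Q i x.1 x.2
      ≤ Fintype.card S * Fintype.card A * H
        + (1 + 1 / (H : ℝ)) * (sumNextValue H c L i l + 2 * sumBonus H c L i l) := by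
  have hH' : (H : ℝ) ≠ 0 := by positivity
  induction l with
  | nil =>
    simp [sumValue, sumNextValue, sumBonus, visits, replay, initMemory]
  | cons y l ih =>
    obtain ⟨h, s, a, s'⟩ := y
    obtain ⟨hga, hg⟩ := hg
    have ih := ih hg
    rw [sumValue, sumNextValue, sumBonus]
    split_ifs with hx
    · subst hx
      rw [sum_eq_sum_add_of_eq_off
        (ψ := fun x : S × A => (1 + (visits h x.1 x.2 l : ℝ) / H) * (replay H c L l).Q h x.1 x.2)
        (s, a) fun x hx => by
          rw [visits_cons_ne h hx, replay_Q_cons_of_not]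
          rintro ⟨-, h1, h2⟩
          exact hx (Prod.ext h1 h2)]
      simp only [visits_cons_self, replay_Q_cons_self, one_sub_rate_succ]
      have hV : vbar H (replay H c L l) h s ≤ (replay H c L l).Q h s a := by
        rw [vbar, if_pos hi]
        exact (min_le_right _ _).trans (Finset.sup'_le _ _ fun b _ => hga b)
      have hid : (1 + ((visits h s a l + 1 : ℕ) : ℝ) / H) *
          (visits h s a l / ((H : ℝ) + visits h s a l + 1) * (replay H c L l).Q h s a
            + rate H (visits h s a l + 1) * (vbar H (replay H c L l) (h + 1) s'
              + 2 * bonus c L H (visits h s a l + 1)))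
          = visits h s a l / H * (replay H c L l).Q h s a + (1 + 1 / (H : ℝ)) *
            (vbar H (replay H c L l) (h + 1) s' + 2 * bonus c L H (visits h s a l + 1)) := by
        have : (H : ℝ) + visits h s a l + 1 ≠ 0 := by positivity
        have : (H : ℝ) + (visits h s a l + 1) ≠ 0 := by positivity
        rw [rate]
        push_cast
        field_simp
        ring
      rw [hid]
      linarith
    · have e : ∀ x : S × A, (1 + (visits i x.1 x.2 ((h, s, a, s') :: l) : ℝ) / H)
          * (replay H c L ((h, s, a, s') :: l)).Q i x.1 x.2
          = (1 + (visits i x.1 x.2 l : ℝ) / H) * (replay H c L l).Q i x.1 x.2 := fun x => by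
        rw [visits_cons_of_step_ne hx, replay_Q_cons_of_not]
        exact fun h' => hx h'.1.symm
      simp only [e]
      exact ih

/-- Properties of the transitions observed in `k` complete episodes and the steps before step `h`
of the next one, when that has reached state `s`. -/
structure EpisodeData (M : EpisodicMDP S A) (c L : ℝ) (k h : ℕ) (s : S)
    (l : List (ℕ × S × A × S)) : Prop where
  greedy : GreedyData M.H c L l
  start : ∀ y ∈ l, y.1 = 1 → y.2.1 = M.s₁
  sum_visits : ∀ i, 1 ≤ i → i ≤ M.H →
    ∑ x : S × A, (visits i x.1 x.2 l : ℝ) = k + if i < h then 1 else 0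
  sumNextValue_eq : ∀ i, 1 ≤ i → sumNextValue M.H c L i l =
    sumValue M.H c L (i + 1) l + if i + 1 = h then vbar M.H (replay M.H c L l) h s else 0
  state_one : h = 1 → s = M.s₁

theorem EpisodeData.nil (M : EpisodicMDP S A) (c L : ℝ) : EpisodeData M c L 0 1 M.s₁ [] where
  greedy := trivial
  start := by simp
  sum_visits i h1 h2 := by simp [visits, Nat.not_lt.2 h1]
  sumNextValue_eq i h1 := by
    rw [if_neg (by omega)]
    simp [sumNextValue, sumValue]
  state_one _ := rfl

theorem EpisodeData.cons {M : EpisodicMDP S A} {c L : ℝ} {k h : ℕ} {s : S}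
    {l : List (ℕ × S × A × S)} (hl : EpisodeData M c L k h s l) (h1 : 1 ≤ h) {a : A}
    (ha : ∀ b, (replay M.H c L l).Q h s b ≤ (replay M.H c L l).Q h s a) (s' : S) :
    EpisodeData M c L k (h + 1) s' ((h, s, a, s') :: l) where
  greedy := ⟨ha, hl.greedy⟩
  start := by
    intro y hy hy1
    rcases List.mem_cons.1 hy with rfl | hy
    · exact hl.state_one hy1
    · exact hl.start y hy hy1
  sum_visits i hi1 hi2 := by
    rw [sum_visits_cons, hl.sum_visits i hi1 hi2, add_assoc]
    congr 1
    rcases lt_trichotomy i h with hlt | rfl | hgt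
    · simp [hlt, hlt.ne', hlt.trans (Nat.lt_succ_self h)]
    · simp
    · rw [if_neg (by omega), if_neg (by omega), if_neg (by omega), add_zero]
  sumNextValue_eq i hi1 := by
    have e := hl.sumNextValue_eq i hi1
    rw [sumNextValue, sumValue]
    rcases eq_or_ne h i with rfl | hne
    -- An update at step h leaves V_{h+1} unchanged, so the next value just recorded is the value
    -- found on arrival.
    · rw [if_pos rfl, if_neg (by omega), if_pos rfl, vbar_replay_cons_of_ne M.H c L (by omega), e,
        if_neg (by omega), add_zero]
    · rw [if_neg hne, if_neg (by omega : ¬ i + 1 = h + 1), e, add_zero]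
      by_cases hih : h = i + 1
      · rw [if_pos hih.symm, if_pos hih]
      · rw [if_neg (Ne.symm hih), if_neg hih, add_zero]
  state_one h := by omega

theorem EpisodeData.next {M : EpisodicMDP S A} {c L : ℝ} {k : ℕ} {s : S}
    {l : List (ℕ × S × A × S)} (hl : EpisodeData M c L k (M.H + 1) s l) :
    EpisodeData M c L (k + 1) 1 M.s₁ l where
  greedy := hl.greedy
  start := hl.start
  sum_visits i hi1 hi2 := by
    rw [hl.sum_visits i hi1 hi2, if_pos (by omega), if_neg (by omega)]
    push_cast
    ring
  sumNextValue_eq i hi1 := by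
    -- The pending value at the end of an episode is V_{H+1} = 0.
    rw [hl.sumNextValue_eq i hi1, vbar, if_neg (show ¬ M.H + 1 ≤ M.H by omega),
      if_neg (show ¬ i + 1 = 1 by omega), ite_self]
  state_one _ := rfl

theorem runSteps_support (M : EpisodicMDP S A) (c L : ℝ) {g : ActionRule S A} (hg : IsGreedy g)
    {k : ℕ} (n h : ℕ) (hn : h + n = M.H + 1) (h1 : 1 ≤ h) (s : S) (m : Memory S A)
    (hm : m = replay M.H c L m.data) (hd : EpisodeData M c L k h s m.data) :
    ∀ m' ∈ (runSteps M c L g n h s m).support,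
      m' = replay M.H c L m'.data ∧ EpisodeData M c L (k + 1) 1 M.s₁ m'.data := by
  induction n generalizing h s m with
  | zero =>
    intro m' hm'
    rw [runSteps, PMF.support_pure, Set.mem_singleton_iff] at hm'
    subst hm'
    obtain rfl : h = M.H + 1 := by omega
    exact ⟨hm, hd.next⟩
  | succ n ih =>
    intro m' hm'
    simp only [runSteps, PMF.mem_support_bind_iff] at hm'
    obtain ⟨a, ha, s', -, hm'⟩ := hm'
    refine ih (h + 1) (by omega) (by omega) s' _ ?_ ?_ m' hm'
    · conv_lhs => rw [hm]
      rfl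
    · have := hg m h s a ha
      rw [hm] at this
      exact hd.cons h1 this s'

theorem runEpisodes_support (M : EpisodicMDP S A) (c L : ℝ) {g : ActionRule S A}
    (hg : IsGreedy g) (k : ℕ) : ∀ m ∈ (runEpisodes M c L g k).support,
      m = replay M.H c L m.data ∧ EpisodeData M c L k 1 M.s₁ m.data := by
  induction k with
  | zero =>
    intro m hm
    rw [runEpisodes, PMF.support_pure, Set.mem_singleton_iff] at hm
    subst hm
    exact ⟨rfl, EpisodeData.nil M c L⟩
  | succ k ih =>
    intro m' hm'
    simp only [runEpisodes, PMF.mem_support_bind_iff] at hm'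
    obtain ⟨m, hm, hm'⟩ := hm'
    exact runSteps_support M c L hg M.H 1 (by omega) le_rfl M.s₁ m (ih m hm).1 (ih m hm).2 m' hm'

theorem mul_sum_visits_le_sumValue (M : EpisodicMDP S A) (c L : ℝ) {v : ℝ}
    {l : List (ℕ × S × A × S)} (hs : ∀ y ∈ l, y.1 = 1 → y.2.1 = M.s₁)
    (hv : ∀ l', l' <:+ l → v ≤ vbar M.H (replay M.H c L l') 1 M.s₁) :
    v * ∑ x : S × A, (visits 1 x.1 x.2 l : ℝ) ≤ sumValue M.H c L 1 l := by
  induction l with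
  | nil => simp [visits, sumValue]
  | cons y l ih =>
    have ih := ih (fun y hy => hs y (List.mem_cons_of_mem _ hy))
      fun l' hl' => hv l' (hl'.trans (List.suffix_cons _ _))
    have hst := hs y List.mem_cons_self
    have hvl := hv l (List.suffix_cons _ _)
    obtain ⟨h, s, a, s'⟩ := y
    rw [sum_visits_cons, sumValue]
    split_ifs with h1
    · subst h1
      obtain rfl : s = M.s₁ := hst rfl
      linarith
    · simpa using ih

theorem one_add_inv_pow_le {H j : ℕ} (hH : 1 ≤ H) (hj : j ≤ H) : (1 + 1 / (H : ℝ)) ^ j ≤ 3 := by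
  have hH' : (0 : ℝ) < H := by exact_mod_cast hH
  calc (1 + 1 / (H : ℝ)) ^ j ≤ (1 + 1 / (H : ℝ)) ^ H :=
        pow_le_pow_right₀ (by simp) hj
    _ ≤ Real.exp (1 / (H : ℝ)) ^ H := by
        gcongr
        linarith [Real.add_one_le_exp (1 / (H : ℝ))]
    _ = Real.exp 1 := by
        rw [← Real.exp_nat_mul]
        congr 1
        field_simp
    _ ≤ 3 := by linarith [Real.exp_one_lt_d9]

theorem EpisodeData.sumValue_one_le {M : EpisodicMDP S A} {c L : ℝ} (hc : 0 ≤ c) (hL : 0 ≤ L)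
    {k : ℕ} {l : List (ℕ × S × A × S)} (hl : EpisodeData M c L k 1 M.s₁ l) (hH : 1 ≤ M.H) :
    sumValue M.H c L 1 l ≤ 3 * M.H * (Fintype.card S * Fintype.card A * M.H
      + 8 * c * √((M.H : ℝ) ^ 3 * L) * √(Fintype.card S * Fintype.card A * k)) := by
  have hH' : (1 : ℝ) ≤ M.H := by exact_mod_cast hH
  set X : ℝ := Fintype.card S * Fintype.card A * M.H
      + 8 * c * √((M.H : ℝ) ^ 3 * L) * √(Fintype.card S * Fintype.card A * k) with hX
  have hX0 : 0 ≤ X := by positivity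
  set r : ℝ := 1 + 1 / (M.H : ℝ) with hr
  have hr2 : r ≤ 2 := by
    rw [hr]
    have : 1 / (M.H : ℝ) ≤ 1 := by rw [div_le_one (by positivity)]; exact hH'
    linarith
  have hr1 : 1 ≤ r := by simp [hr]
  have step : ∀ i, 1 ≤ i → i ≤ M.H →
      sumValue M.H c L i l ≤ X + r * sumNextValue M.H c L i l := by
    intro i hi1 hi2
    have e1 := sumValue_add_sum_le hH c L hl.greedy i hi2
    have e2 : 0 ≤ ∑ x : S × A, (1 + (visits i x.1 x.2 l : ℝ) / M.H)
        * (replay M.H c L l).Q i x.1 x.2 :=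
      Finset.sum_nonneg fun x _ => mul_nonneg (by positivity) (replay_Q_nonneg M.H hc l _ _ _)
    have hk := hl.sum_visits i hi1 hi2
    rw [if_neg (by omega), add_zero] at hk
    have e3 := sumBonus_le hc hL M.H i l hk
    have e4 : r * sumBonus M.H c L i l ≤ 2 *
        (2 * c * √((M.H : ℝ) ^ 3 * L) * √(Fintype.card S * Fintype.card A * k)) := by
      calc r * sumBonus M.H c L i l ≤ r *
          (2 * c * √((M.H : ℝ) ^ 3 * L) * √(Fintype.card S * Fintype.card A * k)) := by gcongr
        _ ≤ _ := by gcongr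
    rw [← hr] at e1
    linarith
  -- Solves U_i ≤ X + r U_{i+1} backwards from step H, bounding every power of r in the geometric
  -- sum by the largest.
  have main : ∀ j, j < M.H → sumValue M.H c L (M.H - j) l ≤ X * ((j + 1) * r ^ j) := by
    intro j
    induction j with
    | zero =>
      intro _
      have := step M.H hH le_rfl
      rw [sumNextValue_last] at this
      simpa using this
    | succ j ih =>
      intro hj
      have e1 := step (M.H - (j + 1)) (by omega) (by omega)
      have e2 := hl.sumNextValue_eq (M.H - (j + 1)) (by omega)
      rw [if_neg (by omega), add_zero, show M.H - (j + 1) + 1 = M.H - j by omega] at e2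
      rw [e2] at e1
      have e3 := mul_le_mul_of_nonneg_left (ih (by omega)) (zero_le_one.trans hr1)
      have e4 : X * 1 ≤ X * r ^ (j + 1) := mul_le_mul_of_nonneg_left (one_le_pow₀ hr1) hX0
      push_cast
      rw [pow_succ] at e4 ⊢
      linarith
  have e := main (M.H - 1) (by omega)
  rw [show M.H - (M.H - 1) = 1 by omega, Nat.cast_sub hH] at e
  push_cast at e
  refine e.trans ?_
  have e5 : r ^ (M.H - 1) ≤ 3 := one_add_inv_pow_le hH (by omega)
  calc X * ((M.H - 1 + 1) * r ^ (M.H - 1)) = X * M.H * r ^ (M.H - 1) := by ring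
    _ ≤ X * M.H * 3 := by gcongr
    _ = _ := by ring

end Values

/-! ### The lower bound for the visit counts -/

/-- If the count `n` is small, then the value of the level `B` is too large for the upper
bound `K δ B ≤ 51 √(H⁵ W K L)`. -/
theorem count_lower_bound {H W K L δ : ℝ} {n : ℕ} {H' : ℕ} (hHH : H = H') (hH : 1 ≤ H)
    (hW : 1 ≤ W) (hK : 1 ≤ K) (hL : 0 < L) (hδ0 : 0 ≤ δ)
    (hthr : 3000 * (H ^ 3 * W * L) ≤ K * δ ^ 2)
    (hupper : K * (level 2 L H' n * δ) ≤ 51 * √(H ^ 5 * W * K * L)) :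
    1 / 200 * (K * δ ^ 2 / (H ^ 2 * W)) ≤ n := by
  have hlev : 0 ≤ level 2 L H' n := level_nonneg zero_le_two L H' n
  set B := level 2 L H' n with hB
  have hsq : K ^ 2 * δ ^ 2 * B ^ 2 ≤ 2601 * (H ^ 5 * W * K * L) := by
    have h1 := pow_le_pow_left₀ (by positivity) hupper 2
    rw [mul_pow 51, Real.sq_sqrt (by positivity)] at h1
    linarith
  -- Here C₁ = 3000 > 51² = 2601 is used; this also excludes n = 0.
  have hnotH : B ≠ H := by
    intro hBH
    rw [hBH] at hsq
    have h2 : 3000 * (H ^ 3 * W * L) * (K * H ^ 2) ≤ K * δ ^ 2 * (K * H ^ 2) := by gcongr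
    have h3 : 0 < H ^ 5 * W * K * L := by positivity
    linarith
  have hn : n ≠ 0 := by
    rintro rfl
    exact hnotH (by rw [hB, level, if_pos rfl, hHH])
  have hn' : (1 : ℝ) ≤ n := by exact_mod_cast Nat.one_le_iff_ne_zero.2 hn
  have hBb : B = 2 * bonus 2 L H' n := by
    rcases min_choice (H' : ℝ) (2 * bonus 2 L H' n) with h | h
    · exact absurd (by rw [hB, level, if_neg hn, h, hHH]) hnotH
    · rw [hB, level, if_neg hn, h]
  have hB2 : B ^ 2 * n = 16 * (H ^ 3 * L) := by
    rw [hBb, bonus, ← hHH, mul_pow, mul_pow, Real.sq_sqrt (by positivity)]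
    field_simp
    norm_num
  rw [mul_div_assoc', div_le_iff₀ (by positivity)]
  have h4 : K ^ 2 * δ ^ 2 * B ^ 2 * n ≤ 2601 * (H ^ 5 * W * K * L) * n := by gcongr
  have h5 : (K * H ^ 3 * L) * (16 * (K * δ ^ 2)) ≤
      (K * H ^ 3 * L) * (2601 * (n * (H ^ 2 * W))) := by
    calc (K * H ^ 3 * L) * (16 * (K * δ ^ 2)) = K ^ 2 * δ ^ 2 * (16 * (H ^ 3 * L)) := by ring
      _ = K ^ 2 * δ ^ 2 * B ^ 2 * n := by rw [← hB2]; ring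
      _ ≤ _ := h4
      _ = _ := by ring
  -- This reads 16 K δ² ≤ 2601 n H² W, and 2601/16 < 200.
  have h6 := le_of_mul_le_mul_left h5 (by positivity)
  have h7 : 0 ≤ n * (H ^ 2 * W) := by positivity
  linarith

/-- The cost `H² W` of the first visits is dominated by the other term. -/
theorem upper_bound_simplify {H W K L : ℝ} (hH : 1 ≤ H) (hW : 1 ≤ W) (hL : 1 / 2 ≤ L)
    (hKW : 3000 * (H ^ 3 * W * L) ≤ K) :
    3 * H * (W * H + 8 * 2 * √(H ^ 3 * L) * √(W * K)) ≤ 51 * √(H ^ 5 * W * K * L) := by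
  have hH3 : 1 ≤ H ^ 3 := one_le_pow₀ hH
  have hK : W ≤ K * L := by
    have h1 : W * 1 ≤ W * (3000 * H ^ 3 * L ^ 2) := by
      gcongr
      nlinarith
    have h2 : 3000 * (H ^ 3 * W * L) * L ≤ K * L := by gcongr
    linarith
  have hK0 : 0 ≤ K := le_trans (by positivity) hKW
  have e1 : H * (√(H ^ 3 * L) * √(W * K)) = √(H ^ 5 * W * K * L) := by
    have hH2 : H = √(H ^ 2) := (Real.sqrt_sq (by linarith)).symm
    rw [← Real.sqrt_mul (by positivity)]
    conv_lhs => arg 1; rw [hH2]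
    rw [← Real.sqrt_mul (by positivity)]
    congr 1
    ring
  have e2 : W * H ^ 2 ≤ √(H ^ 5 * W * K * L) := by
    refine Real.le_sqrt_of_sq_le ?_
    calc (W * H ^ 2) ^ 2 = H ^ 4 * W * W := by ring
      _ ≤ H ^ 5 * W * (K * L) := by
        gcongr
        norm_num
      _ = _ := by ring
  -- 51 = 3 + 3·16, by `e2` and `e1`.
  linarith

/-- L may be arbitrarily close to 0 when SA = 1; otherwise L ≥ log 2. -/
theorem logFactor_bounds {S A : Type*} [Fintype S] [Fintype A] [Nonempty A] {H N K : ℕ}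
    {p : ℝ} (hS : 1 ≤ Fintype.card S) (hH : 1 ≤ H)
    (hK : 1 ≤ K) (hp0 : 0 < p) (hp1 : p < 1) :
    0 ≤ Real.log (Fintype.card S * Fintype.card A * H * K / p) ∧
    Real.log (Fintype.card S * Fintype.card A * H * K / p) ≤ logFactor S A H N K p ∧
    (Fintype.card S * Fintype.card A ≠ 1 → 1 / 2 ≤ logFactor S A H N K p) := by
  have hA : 1 ≤ Fintype.card A := Fintype.card_pos
  have hW1 : 1 ≤ Fintype.card S * Fintype.card A := Nat.mul_pos hS hA
  have hW : (1 : ℝ) ≤ Fintype.card S * Fintype.card A := by exact_mod_cast hW1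
  have hH' : (1 : ℝ) ≤ H := by exact_mod_cast hH
  have hK' : (1 : ℝ) ≤ K := by exact_mod_cast hK
  have hlogN : 0 ≤ Real.log N := Real.log_natCast_nonneg N
  have hge : (Fintype.card S * Fintype.card A : ℝ)
      ≤ Fintype.card S * Fintype.card A * H * K / p := by
    rw [le_div_iff₀ hp0, mul_assoc (_ * _ : ℝ) (H : ℝ)]
    refine mul_le_mul_of_nonneg_left ?_ (by positivity)
    exact hp1.le.trans (one_le_mul_of_one_le_of_one_le hH' hK')
  refine ⟨Real.log_nonneg (hW.trans hge), by unfold logFactor; linarith, fun hne => ?_⟩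
  have h2 : (2 : ℝ) ≤ Fintype.card S * Fintype.card A := by
    exact_mod_cast (by omega : 2 ≤ Fintype.card S * Fintype.card A)
  have h3 := Real.log_le_log zero_lt_two (h2.trans hge)
  unfold logFactor
  linarith [Real.log_two_gt_d9]

/-- The product equals p²/(AK), which is at most p. -/
theorem failure_bound {s a H K : ℕ} {p : ℝ} (hs : 1 ≤ s) (ha : 1 ≤ a) (hH : 1 ≤ H) (hK : 1 ≤ K)
    (hp0 : 0 < p) (hp1 : p < 1) :
    ((H * s * a * (H * s) * K : ℕ) : ℝ≥0∞)
      * ENNReal.ofReal (Real.exp (-(2 * Real.log (s * a * H * K / p)))) ≤ ENNReal.ofReal p := by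
  have hs' : (1 : ℝ) ≤ s := by exact_mod_cast hs
  have ha' : (1 : ℝ) ≤ a := by exact_mod_cast ha
  have hH' : (1 : ℝ) ≤ H := by exact_mod_cast hH
  have hK' : (1 : ℝ) ≤ K := by exact_mod_cast hK
  have hpos : (0 : ℝ) < s * a * H * K / p := by positivity
  have hexp : Real.exp (-(2 * Real.log (s * a * H * K / p))) = (p / (s * a * H * K)) ^ 2 := by
    rw [Real.exp_neg, two_mul, Real.exp_add, Real.exp_log hpos, ← pow_two, ← inv_pow, inv_div]
  rw [hexp, ← ENNReal.ofReal_natCast, ← ENNReal.ofReal_mul (by positivity)]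
  refine ENNReal.ofReal_le_ofReal ?_
  push_cast
  have : (H * s * a * (H * s) * K : ℝ) * (p / (s * a * H * K)) ^ 2 = p * (p / (a * K)) := by
    field_simp
  rw [this]
  refine mul_le_of_le_one_right hp0.le ?_
  rw [div_le_one (by positivity)]
  exact hp1.le.trans (one_le_mul_of_one_le_of_one_le ha' hK')

/-! ### Combination of the two bounds -/

section Main

variable {S A : Type*} [Fintype S] [DecidableEq S] [Fintype A] [DecidableEq A] [Nonempty A]

theorem EpisodeData.visits_le {M : EpisodicMDP S A} {c L : ℝ} {k : ℕ}
    {l : List (ℕ × S × A × S)} (hl : EpisodeData M c L k 1 M.s₁ l) (i : ℕ) (s : S) (a : A)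
    (h1 : 1 ≤ i) (h2 : i ≤ M.H) : visits i s a l ≤ k := by
  have e := hl.sum_visits i h1 h2
  rw [if_neg (by omega), add_zero] at e
  have := Finset.single_le_sum (f := fun x : S × A => (visits i x.1 x.2 l : ℝ))
    (fun x _ => Nat.cast_nonneg _) (Finset.mem_univ (s, a))
  rw [e] at this
  exact_mod_cast this

/-- Settles the case SA = 1, where L has no positive absolute lower bound: the only pair is visited
in every episode. -/
theorem EpisodeData.visits_eq_of_card_eq_one {M : EpisodicMDP S A} {c L : ℝ} {k : ℕ}
    {l : List (ℕ × S × A × S)} (hl : EpisodeData M c L k 1 M.s₁ l)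
    (hcard : Fintype.card S * Fintype.card A = 1) (i : ℕ) (s : S) (a : A)
    (h1 : 1 ≤ i) (h2 : i ≤ M.H) : (visits i s a l : ℝ) = k := by
  have e := hl.sum_visits i h1 h2
  rw [if_neg (by omega), add_zero] at e
  rw [← Fintype.card_prod] at hcard
  have hsub := Fintype.card_le_one_iff_subsingleton.1 hcard.le
  rw [← e, Fintype.sum_eq_single (s, a) fun x hx => absurd (Subsingleton.elim x _) hx]

theorem EpisodeData.count_lower_bound {M : EpisodicMDP S A} {ι L : ℝ} (hι : 0 ≤ ι) (hιL : ι ≤ L)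
    {K : ℕ} (hK : 1 ≤ K) {l : List (ℕ × S × A × S)} (hl : EpisodeData M 2 L K 1 M.s₁ l)
    (hconc : ConcentratedData M K ι l)
    (hL : Fintype.card S * Fintype.card A ≠ 1 → 1 / 2 ≤ L)
    (s : S) (a : A) (h : ℕ) (h1 : 1 ≤ h) (h2 : h ≤ M.H)
    (hthr : 3000 * ((M.H : ℝ) ^ 3 * Fintype.card S * Fintype.card A * L) ≤ K * reach M h s ^ 2) :
    1 / 200 * (K * reach M h s ^ 2 / ((M.H : ℝ) ^ 2 * Fintype.card S * Fintype.card A))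
      ≤ visits h s a l := by
  have hH1 : 1 ≤ M.H := h1.trans h2
  have hH : (1 : ℝ) ≤ M.H := by exact_mod_cast hH1
  have hK' : (1 : ℝ) ≤ K := by exact_mod_cast hK
  have hδ0 : 0 ≤ reach M h s := relReach_nonneg M _ _ _ _
  have hδ1 : reach M h s ≤ 1 := relReach_le_one M _ _ _ _
  have hKδ : K * reach M h s ^ 2 ≤ K :=
    mul_le_of_le_one_right (by positivity) (pow_le_one₀ hδ0 hδ1)
  have : Nonempty S := ⟨s⟩
  have hW1 : 1 ≤ Fintype.card S * Fintype.card A := Nat.mul_pos Fintype.card_pos Fintype.card_pos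
  have hW : (1 : ℝ) ≤ Fintype.card S * Fintype.card A := by exact_mod_cast hW1
  rw [mul_assoc ((M.H : ℝ) ^ 2)]
  rw [mul_assoc ((M.H : ℝ) ^ 3)] at hthr
  by_cases hcard : Fintype.card S * Fintype.card A = 1
  · rw [hl.visits_eq_of_card_eq_one hcard h s a h1 h2]
    have h3 : (1 : ℝ) ≤ (M.H : ℝ) ^ 2 * (Fintype.card S * Fintype.card A) :=
      one_le_mul_of_one_le_of_one_le (one_le_pow₀ hH) hW
    have h4 : K * reach M h s ^ 2 / ((M.H : ℝ) ^ 2 * (Fintype.card S * Fintype.card A)) ≤ K :=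
      (div_le_self (by positivity) h3).trans hKδ
    linarith
  · have hL := hL hcard
    refine UCBZero.count_lower_bound rfl hH hW hK' (by linarith) hδ0 hthr ?_
    have hup := hl.sumValue_one_le zero_le_two (hι.trans hιL) hH1
    have hlow := mul_sum_visits_le_sumValue M 2 L hl.start fun l' hl' =>
      level_mul_reach_le_vbar M hι hιL s a h1 h2 hconc hl.visits_le hl'
    rw [hl.sum_visits 1 le_rfl hH1, if_neg (by omega), add_zero, mul_comm] at hlow
    exact hlow.trans (hup.trans (upper_bound_simplify hH hW hL (hthr.trans hKδ)))

end Main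

end UCBZero

end

theorem theorem2 :
    ∃ c C₁ C₂ : ℝ, 0 < c ∧ 0 < C₁ ∧ 0 < C₂ ∧
      ∀ (S A : Type*) [Fintype S] [DecidableEq S] [Fintype A] [DecidableEq A] [Nonempty A]
        (M : UCBZero.EpisodicMDP S A) (N K : ℕ) (p : ℝ) (g : UCBZero.ActionRule S A),
        1 ≤ N → 0 < p → p < 1 → UCBZero.IsGreedy g →
        ENNReal.ofReal (1 - p) ≤
          (UCBZero.ucbZero M c N K p g).toOuterMeasure
            {m | ∀ (s : S) (a : A) (h : ℕ), 1 ≤ h → h ≤ M.H →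
              C₁ * ((M.H : ℝ) ^ 3 * Fintype.card S * Fintype.card A
                  * UCBZero.logFactor S A M.H N K p) ≤ K * UCBZero.reach M h s ^ 2 →
              C₂ * (K * UCBZero.reach M h s ^ 2
                  / ((M.H : ℝ) ^ 2 * Fintype.card S * Fintype.card A)) ≤ m.count h s a} := by
  refine ⟨2, 3000, 1 / 200, by norm_num, by norm_num, by norm_num, ?_⟩
  intro S A _ _ _ _ _ M N K p g _ hp0 hp1 hg
  by_cases hKH : 1 ≤ K ∧ 1 ≤ M.H
  · obtain ⟨hK, hH⟩ := hKH
    have hS : 1 ≤ Fintype.card S := Fintype.card_pos_iff.2 ⟨M.s₁⟩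
    obtain ⟨hι, hιL, hL⟩ := UCBZero.logFactor_bounds (A := A) hS hH hK hp0 hp1
    refine UCBZero.ofReal_one_sub_le_toOuterMeasure _ hp0.le
      ((UCBZero.toOuterMeasure_not_concentratedData_le M 2 _ g K (T := K) hι).trans
        (UCBZero.failure_bound hS Fintype.card_pos hH hK hp0 hp1)) fun m hm hconc => ?_
    obtain ⟨hrep, hdata⟩ := UCBZero.runEpisodes_support M 2 _ hg K m hm
    intro s a h h1 h2 hthr
    rw [hrep, UCBZero.replay_count]
    exact hdata.count_lower_bound hι hιL hK (not_not.1 hconc) hL s a h h1 h2 hthr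
  -- If H = 0 there is no step h to consider, and if K = 0 the claimed bound is 0.
  · refine UCBZero.ofReal_one_sub_le_toOuterMeasure _ (t := ∅) hp0.le (by simp) ?_
    intro m _ _ s a h h1 h2 _
    obtain rfl : K = 0 := by omega
    simp
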